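/- Let $G$ be the group presented by $$\mathcal P=\langle x,y \mid x^3,\; xyx^{-1}yxy^{-1}x^{-1}y^{-1},\; x^{-1}y^{-4}x^{-1}y^2x^{-1}y^{-1}\rangle .$$ Then $G$ is a finite group of order $243$ and $H_2(G)=H_2(G;\mathbb Z)\cong\mathbb Z_3$. Consequently $\mathcal P$ is efficient, where a presentation of a finite group $K$ with $g$ generators and $r$ relators is called efficient if $r-g$ equals the number of invariant factors of $H_2(K)$. Moreover, every endomorphism $\phi$ of $G$ induces either the zero map or the identity on $H_2(G)$, and $G$ is a Bing group. Here a finite group $K$, with $d_1\mid\dots\mid d_k$ the invariant factors (all greater than $1$) of $H_2(K)$, is called a Bing group if for every endomorphism $\phi\colon K\to K$ we have $\operatorname{tr}(H_2(\phi)\otimes \mathrm{id}_{\mathbb Z_{d_1}})\neq -1$ in $\mathbb Z_{d_1}$ (no condition being imposed if $H_2(K)=0$). -/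

import Mathlib

open scoped TensorProduct CategoryTheory

noncomputable section

namespace BingGroups

/-- A finite presentation with `g` generators and `r` relators. The relators form an indexed
family, so a repeated relator counts with its multiplicity. -/
structure FinitePresentation where
  /-- number of generators -/
  g : ℕ
  /-- number of relators -/
  r : ℕ
  /-- the relators, as elements of the free group on the generators -/
  rel : Fin r → FreeGroup (Fin g)

/-- The group presented by a finite presentation. -/
abbrev FinitePresentation.PresGroup (P : FinitePresentation) : Type :=
  PresentedGroup (Set.range P.rel)

/-- The second integral homology group `H₂(G) = H₂(G; ℤ)`, with `ℤ` the trivial `G`-module. -/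
abbrev H₂ (G : Type) [Group G] : Type :=
  groupHomology (Rep.trivial ℤ G ℤ) 2

/-- For `φ : G → K`, the identity of `ℤ` as a morphism from the trivial `G`-module `ℤ` to the
restriction along `φ` of the trivial `K`-module `ℤ`. -/
def trivialHom {G K : Type} [Group G] [Group K] (φ : G →* K) :
    Rep.trivial ℤ G ℤ ⟶ Rep.res φ (Rep.trivial ℤ K ℤ) :=
  Rep.ofHom ⟨LinearMap.id, fun _ => rfl⟩

/-- The map `H₂(φ) : H₂(G) → H₂(K)` induced by a group homomorphism `φ : G → K`. -/
def H₂map {G K : Type} [Group G] [Group K] (φ : G →* K) : H₂ G →ₗ[ℤ] H₂ K :=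
  (groupHomology.map φ (trivialHom φ) 2).hom

/-- `d = [d₁, …, d_k]` is the list of invariant factors of the finite abelian group `A`: all
`dᵢ > 1`, `d₁ ∣ d₂ ∣ ⋯ ∣ d_k`, and `A` is isomorphic to `ℤ/d₁ × ⋯ × ℤ/d_k`. (The trivial group
has the empty list of invariant factors.) -/
structure IsInvariantFactors (A : Type) [AddCommGroup A] (d : List ℕ) : Prop where
  one_lt : ∀ n ∈ d, 1 < n
  dvd : d.IsChain (· ∣ ·)
  equiv : Nonempty (A ≃+ ((i : Fin d.length) → ZMod (d.get i)))

/-- A presentation `P` of a finite group `G` is efficient if (number of relators) - (number of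
generators) equals the number of invariant factors of `H₂(G)`. -/
def FinitePresentation.IsEfficient (P : FinitePresentation) : Prop :=
  Finite P.PresGroup ∧
    ∃ d : List ℕ, IsInvariantFactors (H₂ P.PresGroup) d ∧ (P.r : ℤ) - (P.g : ℤ) = d.length

/-- A finite group `G` is a Bing group if, for `d₁ ∣ ⋯ ∣ d_k` the invariant factors of `H₂(G)`,
every endomorphism `φ` of `G` satisfies `tr (H₂(φ) ⊗ id_{ℤ/d₁}) ≠ -1` in `ℤ/d₁`. (No condition is
imposed when `H₂(G) = 0`.) The tensor factor `ℤ/d₁` is written on the left, and the trace is that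
of the endomorphism `id ⊗ H₂(φ)` of the free `ℤ/d₁`-module `ℤ/d₁ ⊗ H₂(G)`. -/
def IsBingGroup (G : Type) [Group G] : Prop :=
  Finite G ∧ ∃ d : List ℕ, IsInvariantFactors (H₂ G) d ∧
    ∀ d₁ ∈ d.head?, ∀ φ : G →* G,
      LinearMap.trace (ZMod d₁) (ZMod d₁ ⊗[ℤ] H₂ G) ((H₂map φ).baseChange (ZMod d₁)) ≠ -1

/-- The presentation
`⟨x, y | x³, x y x⁻¹ y x y⁻¹ x⁻¹ y⁻¹, x⁻¹ y⁻⁴ x⁻¹ y² x⁻¹ y⁻¹⟩`. -/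
def presP : FinitePresentation where
  g := 2
  r := 3
  rel :=
    let x : FreeGroup (Fin 2) := FreeGroup.of 0
    let y : FreeGroup (Fin 2) := FreeGroup.of 1
    ![x ^ 3,
      x * y * x⁻¹ * y * x * y⁻¹ * x⁻¹ * y⁻¹,
      x⁻¹ * (y ^ 4)⁻¹ * x⁻¹ * y ^ 2 * x⁻¹ * y⁻¹]

end BingGroups

end

/-! Write b = xyx⁻¹ and c = xbx⁻¹. The second relator is the commutator [b, y], and once x³ = 1 the
third says y = b²c⁻⁴. So b and c commute, conjugation by x permutes b, c, y cyclically, and the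
relations force b⁹ = c⁹ = 1, whence |G| ≤ 243. In the group `Cover` of order 729 the first and third
relators hold, while the second becomes a central element z of order 3; thus G ≅ Cover/⟨z⟩ has order
exactly 243.

Homology is computed by Hopf's formula inside `BarExt`, the central extension of G by 2-chains
modulo 2-boundaries. The exponent sums of the relators are (3,0), (0,0), (-3,-3), so only the second
contributes to H₂: its class generates (`exists_zsmul_relClass`). It is killed by 3
(`relB_pow_three`) and is nonzero because it maps to z in `Cover`.

An endomorphism of G carries this class to the second relator evaluated at a pair in `Cover` that
satisfies all relators modulo z. The possible values are only 1 and z, never z²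
(`Cover.relB_eq_one_or`): in the one case that can be nontrivial the exponent of z is a square
modulo 3. Hence the class is multiplied by 0 or 1, and the trace cannot be -1. -/

open scoped TensorProduct CategoryTheory

noncomputable section

namespace BingGroups

open groupHomology Finsupp

/-! ### Bar chains modulo boundaries, and second homology inside them. -/

section Chains

variable (G : Type) [Group G]

/-- The integral `2`-boundaries of the bar complex of `G`. -/
abbrev bdry : Submodule ℤ (G × G →₀ ℤ) := boundaries₂ (Rep.trivial ℤ G ℤ)

/-- The integral `2`-cycles of the bar complex of `G`. -/
abbrev cycl : Submodule ℤ (G × G →₀ ℤ) := cycles₂ (Rep.trivial ℤ G ℤ)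

/-- Integral `2`-chains of the bar complex of `G` modulo `2`-boundaries. -/
abbrev BarQuot : Type := (G × G →₀ ℤ) ⧸ bdry G

variable {G}

/-- The class of `[g | h]` modulo boundaries: the universal `2`-cocycle. -/
def bar (g h : G) : BarQuot G := (bdry G).mkQ (single (g, h) 1)

theorem bar_cocycle (g h k : G) : bar g h + bar (g * h) k = bar h k + bar g (h * k) := by
  have hmem : (single (h, k) 1 - single (g * h, k) 1 + single (g, h * k) 1 - single (g, h) 1 :
      G × G →₀ ℤ) ∈ bdry G := by
    refine ⟨single (g, h, k) (1 : ℤ), ?_⟩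
    simpa using d₃₂_single (A := Rep.trivial ℤ G ℤ) (g, h, k) (1 : ℤ)
  have h0 := (Submodule.Quotient.mk_eq_zero (bdry G)).2 hmem
  have h1 : bar h k - bar (g * h) k + bar g (h * k) - bar g h = 0 := h0
  rw [← sub_eq_zero, ← neg_eq_zero, ← h1]
  abel

theorem bar_one_left (g : G) : bar 1 g = bar (1 : G) 1 := by
  have := bar_cocycle 1 1 g
  simp only [mul_one, one_mul] at this
  exact (add_right_cancel this).symm

theorem bar_one_right (g : G) : bar g 1 = bar (1 : G) 1 := by
  have := bar_cocycle g 1 1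
  simp only [mul_one] at this
  exact add_right_cancel this

/-- The boundary map from `2`-chains to `1`-chains. -/
def chainBd : (G × G →₀ ℤ) →ₗ[ℤ] (G →₀ ℤ) := (d₂₁ (Rep.trivial ℤ G ℤ)).hom

theorem chainBd_single (g h : G) (n : ℤ) :
    chainBd (single (g, h) n) = single h n - single (g * h) n + single g n := by
  exact (d₂₁_single (A := Rep.trivial ℤ G ℤ) (g, h) n).trans (by simp)

/-- The boundary map on `2`-chains modulo boundaries. -/
def barBd : BarQuot G →ₗ[ℤ] (G →₀ ℤ) :=
  (bdry G).liftQ chainBd (boundaries₂_le_cycles₂ (Rep.trivial ℤ G ℤ))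

theorem barBd_bar (g h : G) : barBd (bar g h) = single h 1 - single (g * h) 1 + single g 1 :=
  chainBd_single g h 1

theorem mem_cycl {c : G × G →₀ ℤ} : c ∈ cycl G ↔ chainBd c = 0 := Iff.rfl

/-- The projection from cycles to homology. -/
def cyclesToH₂ : cycl G →ₗ[ℤ] H₂ G := (H2π (Rep.trivial ℤ G ℤ)).hom

theorem cyclesToH₂_surjective : Function.Surjective (cyclesToH₂ (G := G)) :=
  (ModuleCat.epi_iff_surjective _).1 (inferInstance : CategoryTheory.Epi (H2π (Rep.trivial ℤ G ℤ)))

theorem cyclesToH₂_eq_zero_iff (c : cycl G) : cyclesToH₂ c = 0 ↔ c.1 ∈ bdry G :=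
  H2π_eq_zero_iff (A := Rep.trivial ℤ G ℤ) c

theorem ker_cyclesToH₂ :
    LinearMap.ker (cyclesToH₂ (G := G)) = LinearMap.ker ((bdry G).mkQ ∘ₗ (cycl G).subtype) := by
  ext c
  rw [LinearMap.mem_ker, cyclesToH₂_eq_zero_iff, LinearMap.mem_ker]
  exact (Submodule.Quotient.mk_eq_zero _).symm

/-- The embedding of homology into chains modulo boundaries. -/
def homologyToBar : H₂ G →ₗ[ℤ] BarQuot G :=
  ((LinearMap.ker cyclesToH₂).liftQ ((bdry G).mkQ ∘ₗ (cycl G).subtype) ker_cyclesToH₂.le) ∘ₗ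
    (cyclesToH₂.quotKerEquivOfSurjective cyclesToH₂_surjective).symm.toLinearMap

theorem homologyToBar_cyclesToH₂ (c : cycl G) :
    homologyToBar (cyclesToH₂ c) = (bdry G).mkQ c.1 := by
  have : (cyclesToH₂.quotKerEquivOfSurjective cyclesToH₂_surjective).symm (cyclesToH₂ c) =
      (LinearMap.ker cyclesToH₂).mkQ c := by
    rw [LinearEquiv.symm_apply_eq]; rfl
  simp only [homologyToBar, LinearMap.comp_apply, LinearEquiv.coe_coe, this]
  rfl

theorem homologyToBar_injective : Function.Injective (homologyToBar (G := G)) := by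
  rw [injective_iff_map_eq_zero]
  intro z hz
  obtain ⟨c, rfl⟩ := cyclesToH₂_surjective z
  rw [homologyToBar_cyclesToH₂] at hz
  exact (cyclesToH₂_eq_zero_iff c).2 ((Submodule.Quotient.mk_eq_zero _).1 hz)

theorem exists_homologyToBar_eq {q : BarQuot G} (hq : barBd q = 0) :
    ∃ z : H₂ G, homologyToBar z = q := by
  obtain ⟨c, rfl⟩ := Submodule.mkQ_surjective _ q
  exact ⟨cyclesToH₂ ⟨c, hq⟩, homologyToBar_cyclesToH₂ _⟩

variable {K : Type} [Group K]

/-- The map induced on `2`-chains by a group homomorphism. -/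
def chainMap (φ : G →* K) : (G × G →₀ ℤ) →ₗ[ℤ] (K × K →₀ ℤ) :=
  lmapDomain ℤ ℤ (Prod.map φ φ)

theorem chainMap_single (φ : G →* K) (g h : G) (n : ℤ) :
    chainMap φ (single (g, h) n) = single (φ g, φ h) n := mapDomain_single

theorem chainMap_mem_bdry (φ : G →* K) : bdry G ≤ (bdry K).comap (chainMap φ) := by
  rintro _ ⟨c, rfl⟩
  induction c using Finsupp.induction_linear with
  | zero => rw [map_zero]; exact zero_mem _
  | add c d hc hd => rw [map_add]; exact add_mem hc hd
  | single g n =>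
    obtain ⟨g, h, k⟩ := g
    refine ⟨single (φ g, φ h, φ k) (n : ℤ), ?_⟩
    erw [d₃₂_single, d₃₂_single]
    simp [chainMap, mapDomain_add, mapDomain_sub, mapDomain_single]

/-- The map induced on chains modulo boundaries by a group homomorphism. -/
def barMap (φ : G →* K) : BarQuot G →ₗ[ℤ] BarQuot K :=
  (bdry G).mapQ (bdry K) (chainMap φ) (chainMap_mem_bdry φ)

theorem barMap_bar (φ : G →* K) (g h : G) : barMap φ (bar g h) = bar (φ g) (φ h) := by
  simp only [bar, barMap, Submodule.mkQ_apply, Submodule.mapQ_apply, chainMap_single]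

theorem homologyToBar_H₂map (φ : G →* K) (z : H₂ G) :
    homologyToBar (H₂map φ z) = barMap φ (homologyToBar z) := by
  obtain ⟨c, rfl⟩ := cyclesToH₂_surjective z
  have h1 : H₂map φ (cyclesToH₂ c) =
      cyclesToH₂ ((mapCycles₂ φ (trivialHom φ)).hom c) :=
    congr($(H2π_comp_map φ (trivialHom φ)) c)
  rw [h1, homologyToBar_cyclesToH₂, homologyToBar_cyclesToH₂]
  change _ = (bdry K).mkQ (chainMap φ c.1)
  congr 1
  change chainsMap₂ φ (trivialHom φ) c.1 = _
  ext p
  rfl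

end Chains

end BingGroups

namespace BingGroups

open Finsupp
open scoped IsMulCommutative

/-! ### The universal bar extension and Hopf's formula. -/

section Extension

/-- The central extension of `G` by chains modulo boundaries, with cocycle `bar`. -/
@[ext] structure BarExt (G : Type) [Group G] where
  /-- the image in `G` -/
  base : G
  /-- the coordinate in the kernel -/
  fib : BarQuot G

namespace BarExt

variable {G : Type} [Group G]

instance : Mul (BarExt G) := ⟨fun a b => ⟨a.base * b.base, a.fib + b.fib + bar a.base b.base⟩⟩

/-- The cocycle `bar` is not normalised, so the identity carries the correction -[1|1]; the same
correction appears in inverses and in `incl`. -/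
instance : One (BarExt G) := ⟨⟨1, -bar 1 1⟩⟩

instance : Inv (BarExt G) :=
  ⟨fun a => ⟨a.base⁻¹, -a.fib - bar a.base⁻¹ a.base - bar 1 1⟩⟩

@[simp] theorem mul_base (a b : BarExt G) : (a * b).base = a.base * b.base := rfl
@[simp] theorem mul_fib (a b : BarExt G) :
    (a * b).fib = a.fib + b.fib + bar a.base b.base := rfl
@[simp] theorem one_base : (1 : BarExt G).base = 1 := rfl
@[simp] theorem one_fib : (1 : BarExt G).fib = -bar 1 1 := rfl
@[simp] theorem inv_base (a : BarExt G) : a⁻¹.base = a.base⁻¹ := rfl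
@[simp] theorem inv_fib (a : BarExt G) :
    a⁻¹.fib = -a.fib - bar a.base⁻¹ a.base - bar 1 1 := rfl

instance : Group (BarExt G) :=
  Group.ofLeftAxioms
    (fun a b c => by
      ext1
      · simp [mul_assoc]
      · have := bar_cocycle a.base b.base c.base
        simp only [mul_fib, mul_base]
        rw [← sub_eq_zero] at this ⊢
        rw [← this]
        abel)
    (fun a => by
      ext1
      · simp
      · simp only [mul_fib, one_fib, one_base, bar_one_left]
        abel)
    (fun a => by
      ext1
      · simp
      · simp only [mul_fib, inv_fib, inv_base, one_fib]
        abel)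

/-- The projection to `G`. -/
def proj : BarExt G →* G where
  toFun := base
  map_one' := rfl
  map_mul' _ _ := rfl

/-- The inclusion of the kernel. -/
def incl : Multiplicative (BarQuot G) →* BarExt G where
  toFun q := ⟨1, q.toAdd - bar 1 1⟩
  map_one' := by ext1 <;> simp
  map_mul' p q := by
    ext1
    · simp
    · simp only [toAdd_mul, mul_fib]
      abel

theorem incl_base (q : Multiplicative (BarQuot G)) : (incl q).base = 1 := rfl

theorem incl_fib (q : Multiplicative (BarQuot G)) : (incl q).fib = q.toAdd - bar 1 1 := rfl

theorem incl_injective : Function.Injective (incl (G := G)) := fun _ _ h =>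
  Multiplicative.toAdd.injective (sub_left_injective (congrArg fib h))

theorem incl_mem_center (q : Multiplicative (BarQuot G)) : incl q ∈ Subgroup.center (BarExt G) := by
  rw [Subgroup.mem_center_iff]
  intro a
  ext1
  · simp [incl_base]
  · simp only [mul_fib, incl_fib, incl_base, bar_one_left, bar_one_right]
    abel

theorem eq_incl {a : BarExt G} (ha : a.base = 1) :
    a = incl (Multiplicative.ofAdd (a.fib + bar 1 1)) := by
  ext1
  · exact ha
  · rw [incl_fib, toAdd_ofAdd, add_sub_cancel_right]

theorem mem_center {a : BarExt G} (ha : a.base = 1) : a ∈ Subgroup.center (BarExt G) :=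
  eq_incl ha ▸ incl_mem_center _

/-- The boundary map as a homomorphism to the additive group of `1`-chains. -/
def bd : BarExt G →* Multiplicative (G →₀ ℤ) where
  toFun a := Multiplicative.ofAdd (single a.base 1 + barBd a.fib)
  map_one' := by
    rw [← ofAdd_zero]
    congr 1
    simp [barBd_bar]
  map_mul' a b := by
    rw [← ofAdd_add]
    congr 1
    -- The boundary h - gh + g of [g|h] is exactly the defect of g ↦ [g] from additivity.
    simp only [mul_base, mul_fib, map_add, barBd_bar]
    abel

theorem bd_incl (q : BarQuot G) :
    bd (incl (Multiplicative.ofAdd q)) = Multiplicative.ofAdd (barBd q) := by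
  change Multiplicative.ofAdd _ = _
  congr 1
  simp [incl_fib, incl_base, barBd_bar]

/-- The inclusion of second homology into the kernel of the extension. -/
def ofH₂ : Multiplicative (H₂ G) →* BarExt G :=
  incl.comp (AddMonoidHom.toMultiplicative homologyToBar.toAddMonoidHom)

theorem ofH₂_apply (z : H₂ G) :
    ofH₂ (Multiplicative.ofAdd z) = incl (Multiplicative.ofAdd (homologyToBar z)) := rfl

theorem ofH₂_injective : Function.Injective (ofH₂ (G := G)) := fun _ _ h =>
  homologyToBar_injective (incl_injective h)

/-- Over 1, `bd` is the boundary map, so its kernel there is H₂. Since `bd` has a commutative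
target, a word with zero exponent sums that evaluates to 1 in G automatically gives a homology
class. -/
theorem exists_ofH₂_eq {a : BarExt G} (ha : a.base = 1) (hb : bd a = 1) :
    ∃ z : H₂ G, ofH₂ (Multiplicative.ofAdd z) = a := by
  rw [eq_incl ha, bd_incl] at hb
  obtain ⟨z, hz⟩ := exists_homologyToBar_eq (Multiplicative.ofAdd.injective hb)
  exact ⟨z, by rw [ofH₂_apply, hz, ← eq_incl ha]⟩

variable {K : Type} [Group K]

/-- Functoriality of the extension. -/
def map (φ : G →* K) : BarExt G →* BarExt K where
  toFun a := ⟨φ a.base, barMap φ a.fib⟩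
  map_one' := by ext1 <;> simp [barMap_bar]
  map_mul' a b := by ext1 <;> simp [barMap_bar]

theorem map_ofH₂ (φ : G →* K) (z : H₂ G) :
    map φ (ofH₂ (Multiplicative.ofAdd z)) = ofH₂ (Multiplicative.ofAdd (H₂map φ z)) := by
  ext1
  · exact map_one φ
  · rw [ofH₂_apply, ofH₂_apply, homologyToBar_H₂map]
    change barMap φ (homologyToBar z - bar 1 1) = barMap φ (homologyToBar z) - bar 1 1
    rw [map_sub, barMap_bar, map_one]

/-- The extension maps to every central extension of `G`. -/
theorem exists_hom_centralExtension {M : Type} [Group M] (p : M →* G)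
    (hp : Function.Surjective p) (hc : p.ker ≤ Subgroup.center M) :
    ∃ Θ : BarExt G →* M, ∀ a, p (Θ a) = a.base := by
  choose s hs using hp
  have hmem (g h : G) : s g * s h * (s (g * h))⁻¹ ∈ p.ker := by
    simp [MonoidHom.mem_ker, hs]
  let f (g h : G) : Additive (Subgroup.center M) :=
    Additive.ofMul ⟨s g * s h * (s (g * h))⁻¹, hc (hmem g h)⟩
  have hf (g h : G) : s g * s h = ((f g h).toMul : M) * s (g * h) := by simp [f]
  have hz (z : Additive (Subgroup.center M)) (m : M) : m * (z.toMul : M) = z.toMul * m :=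
    Subgroup.mem_center_iff.1 z.toMul.2 m
  have hcoc (g h k : G) : f g h + f (g * h) k = f h k + f g (h * k) := by
    apply Additive.toMul.injective
    apply Subtype.ext
    change ((f g h).toMul : M) * (f (g * h) k).toMul = (f h k).toMul * (f g (h * k)).toMul
    apply mul_right_cancel (b := s (g * h * k))
    rw [mul_assoc, ← hf, ← mul_assoc, ← hf, mul_assoc, mul_assoc g, mul_assoc, ← hf, hf h k,
      ← mul_assoc, hz, mul_assoc]
  -- The factor set of the section `s` is a 2-cocycle, so its linear extension kills boundaries and
  -- descends to `BarQuot G`.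
  let c : (G × G →₀ ℤ) →ₗ[ℤ] Additive (Subgroup.center M) :=
    Finsupp.lsum ℤ fun x => LinearMap.toSpanSingleton ℤ _ (f x.1 x.2)
  have hcs (g h : G) (n : ℤ) : c (single (g, h) n) = n • f g h := by simp [c]
  have hcb : bdry G ≤ LinearMap.ker c := by
    rintro _ ⟨d, rfl⟩
    induction d using Finsupp.induction_linear with
    | zero => rw [map_zero]; exact zero_mem _
    | add c d hc hd => rw [map_add]; exact add_mem hc hd
    | single g n =>
      obtain ⟨g, h, k⟩ := g
      erw [groupHomology.d₃₂_single]
      change c (single (h, k) n - single (g * h, k) n + single (g, h * k) n - single (g, h) n) = 0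
      simp only [map_sub, map_add, hcs, ← smul_sub, ← smul_add]
      have : f h k - f (g * h) k + f g (h * k) - f g h = 0 := by
        have := hcoc g h k
        rw [← sub_eq_zero] at this
        rw [← neg_eq_zero, ← this]
        abel
      rw [this, smul_zero]
  let κ : BarQuot G →ₗ[ℤ] Additive (Subgroup.center M) := (bdry G).liftQ c hcb
  have hκb (g h : G) : κ (bar g h) = f g h := (hcs g h 1).trans (one_smul _ _)
  have hκ (q : BarQuot G) : ((κ q).toMul : M) ∈ p.ker := by
    obtain ⟨d, rfl⟩ := Submodule.mkQ_surjective _ q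
    change ((c d).toMul : M) ∈ p.ker
    induction d using Finsupp.induction_linear with
    | zero => rw [map_zero]; exact one_mem _
    | add c d hc hd => rw [map_add]; exact mul_mem hc hd
    | single g n =>
      rw [hcs]
      exact zpow_mem (hmem g.1 g.2) n
  let Θ : BarExt G →* M := MonoidHom.mk' (fun a => ((κ a.fib).toMul : M) * s a.base) <| by
    intro a b
    simp only [mul_base, mul_fib, map_add, hκb, toMul_add, Subgroup.coe_mul]
    rw [mul_assoc, ← hf, mul_assoc, mul_assoc, ← mul_assoc (s a.base), hz, mul_assoc]
  refine ⟨Θ, fun a => ?_⟩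
  change p (((κ a.fib).toMul : M) * s a.base) = a.base
  rw [map_mul, (hκ a.fib : p _ = 1), hs, one_mul]

end BarExt

/-- Hopf's formula, surjectivity: every class in `H₂ G` comes from a relation with trivial image
in each commutative group to which the free group maps. -/
theorem exists_relation_of_H₂ {F G A : Type} [Group F] [Group G] [CommGroup A]
    (π : F →* G) (hπ : Function.Surjective π) (Φ : F →* BarExt G)
    (hΦ : ∀ w, (Φ w).base = π w) (α : F →* A) (z : H₂ G) :
    ∃ w, π w = 1 ∧ α w = 1 ∧ Φ w = BarExt.ofH₂ (Multiplicative.ofAdd z) := by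
  choose s hs using hπ
  let γ (g : G) : BarQuot G := (Φ (s g)).fib
  have hγ (g : G) : Φ (s g) = ⟨g, γ g⟩ := BarExt.ext ((hΦ _).trans (hs g)) rfl
  let β : (G →₀ ℤ) →ₗ[ℤ] BarQuot G × Additive A :=
    Finsupp.lsum ℤ fun g => LinearMap.toSpanSingleton ℤ _ (γ g, Additive.ofMul (α (s g)))
  have hβ (g : G) (n : ℤ) : β (single g n) = n • (γ g, Additive.ofMul (α (s g))) := by simp [β]
  -- Each [g|h] is realised by the word s(g) s(h) s(gh)⁻¹. The choice of lifts adds an error that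
  -- depends only on the boundary of the chain, through `β`; it vanishes on cycles.
  have key (c : G × G →₀ ℤ) : ∃ w, π w = 1 ∧ α w = (β (chainBd c)).2.toMul ∧
      Φ w = BarExt.incl (Multiplicative.ofAdd ((bdry G).mkQ c + (β (chainBd c)).1)) := by
    induction c using Finsupp.induction_linear with
    | zero => exact ⟨1, by simp⟩
    | add c d hc hd =>
      obtain ⟨v, hv1, hv2, hv3⟩ := hc
      obtain ⟨w, hw1, hw2, hw3⟩ := hd
      refine ⟨v * w, by rw [map_mul, hv1, hw1, one_mul], ?_, ?_⟩
      · rw [map_mul, hv2, hw2, map_add, map_add]; rfl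
      · rw [map_mul, hv3, hw3, ← map_mul, ← ofAdd_add]
        congr 2
        rw [map_add, map_add, map_add, Prod.fst_add]
        abel
    | single g n =>
      obtain ⟨g, h⟩ := g
      have hw : π (s g * s h * (s (g * h))⁻¹) = 1 := by simp [hs]
      have hb : β (chainBd (single (g, h) n)) =
          n • ((γ h, Additive.ofMul (α (s h))) - (γ (g * h), Additive.ofMul (α (s (g * h)))) +
            (γ g, Additive.ofMul (α (s g)))) := by
        rw [chainBd_single, map_add, map_sub, hβ, hβ, hβ, smul_add, smul_sub]
      have hq : (bdry G).mkQ (single (g, h) n) = n • bar g h := by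
        rw [bar, ← map_smul]; simp
      refine ⟨(s g * s h * (s (g * h))⁻¹) ^ n, by rw [map_zpow, hw, one_zpow], ?_, ?_⟩
      · rw [hb, map_zpow]
        simp only [Prod.smul_snd, Prod.snd_add, Prod.snd_sub, toMul_zsmul, toMul_add, toMul_sub,
          toMul_ofMul, map_mul, map_inv]
        congr 1
        rw [div_mul_eq_mul_div, mul_comm (α (s h)), div_eq_mul_inv]
      · rw [hb, hq, map_zpow, Prod.smul_fst, ← smul_add, ofAdd_zsmul, map_zpow]
        congr 1
        rw [map_mul, map_inv, mul_inv_eq_iff_eq_mul, map_mul, hγ, hγ, hγ]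
        ext1
        · change g * h = 1 * (g * h)
          rw [one_mul]
        · simp only [BarExt.mul_fib, BarExt.incl_fib, BarExt.incl_base, toAdd_ofAdd, Prod.fst_add,
            Prod.fst_sub, bar_one_left]
          abel
  obtain ⟨c, rfl⟩ := cyclesToH₂_surjective z
  obtain ⟨w, h1, h2, h3⟩ := key c.1
  rw [mem_cycl.1 c.2] at h2 h3
  refine ⟨w, h1, by simpa using h2, ?_⟩
  rw [h3, BarExt.ofH₂_apply, homologyToBar_cyclesToH₂]
  simp

/-- If a homomorphism sends the relators to central elements, then it sends each consequence of the
relators to a product of powers of the images of the relators. -/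
theorem exists_zpow_of_mem_normalClosure {F L : Type} [Group F] [Group L] {r : ℕ} (rel : Fin r → F)
    (Ψ : F →* L) (h : ∀ i, Ψ (rel i) ∈ Subgroup.center L) {w : F}
    (hw : w ∈ Subgroup.normalClosure (Set.range rel)) :
    ∃ n : Fin r → ℤ,
      Ψ w = ((∏ i, (⟨Ψ (rel i), h i⟩ : Subgroup.center L) ^ n i : Subgroup.center L) : L) := by
  let P : (Fin r → ℤ) → Subgroup.center L := fun n => ∏ i, ⟨Ψ (rel i), h i⟩ ^ n i
  change ∃ n, Ψ w = P n
  induction hw using Subgroup.closure_induction with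
  | mem x hx =>
    obtain ⟨_, ⟨i, rfl⟩, hi⟩ := Group.mem_conjugatesOfSet_iff.1 hx
    obtain ⟨c, rfl⟩ := isConj_iff.1 hi
    refine ⟨Pi.single i 1, ?_⟩
    have : P (Pi.single i 1) = ⟨Ψ (rel i), h i⟩ := by
      rw [← zpow_one (⟨Ψ (rel i), h i⟩ : Subgroup.center L)]
      refine (Finset.prod_eq_single i (fun j _ hj => ?_) (by simp)).trans (by simp)
      rw [Pi.single_eq_of_ne hj, zpow_zero]
    rw [this, map_mul, map_mul, Subgroup.mem_center_iff.1 (h i), map_inv, mul_inv_cancel_right]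
  | one => exact ⟨0, by simp [P]⟩
  | mul x y _ _ hx hy =>
    obtain ⟨m, hm⟩ := hx
    obtain ⟨n, hn⟩ := hy
    refine ⟨m + n, ?_⟩
    have : P (m + n) = P m * P n := by
      simp only [P, Pi.add_apply, zpow_add, Finset.prod_mul_distrib]
    rw [map_mul, hm, hn, this, Subgroup.coe_mul]
  | inv x _ hx =>
    obtain ⟨m, hm⟩ := hx
    refine ⟨-m, ?_⟩
    have : P (-m) = (P m)⁻¹ := by simp only [P, Pi.neg_apply, zpow_neg, Finset.prod_inv_distrib]
    rw [map_inv, hm, this, Subgroup.coe_inv]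

end Extension

end BingGroups

namespace BingGroups

/-! ### Consequences of the relators, exact or up to central elements. -/

section Relations

variable {L : Type} [Group L]

/-- The second relator of `presP`. -/
def relB (x y : L) : L := x * y * x⁻¹ * y * x * y⁻¹ * x⁻¹ * y⁻¹

/-- The third relator of `presP`. -/
def relC (x y : L) : L := x⁻¹ * (y ^ 4)⁻¹ * x⁻¹ * y ^ 2 * x⁻¹ * y⁻¹

theorem map_relB {L' : Type} [Group L'] (f : L →* L') (x y : L) :
    f (relB x y) = relB (f x) (f y) := by simp [relB]

theorem map_relC {L' : Type} [Group L'] (f : L →* L') (x y : L) :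
    f (relC x y) = relC (f x) (f y) := by simp [relC]

theorem relB_comm {A : Type} [CommGroup A] (x y : A) : relB x y = 1 := by
  have : relB x y = (x * x⁻¹) * (x * x⁻¹) * (y * y⁻¹) * (y * y⁻¹) := by
    simp only [relB, mul_assoc, mul_left_comm, mul_comm]
  rw [this]
  simp

/-- In terms of b = xyx⁻¹ and c = xbx⁻¹, the third relator expresses y as c⁻⁴b², up to the factors
x³ and the relator itself. -/
theorem relC_eq (x y : L) :
    ((x * (x * y * x⁻¹) * x⁻¹) ^ 4)⁻¹ * (x * y * x⁻¹) ^ 2 = x ^ 3 * relC x y * y := by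
  simp only [conj_pow, relC]
  simp only [pow_succ, pow_zero, one_mul, mul_inv_rev, inv_inv, mul_assoc, inv_mul_cancel_left,
    mul_inv_cancel_left, inv_mul_cancel, mul_one]

theorem conj_conj_conj {x y : L} (hA : x ^ 3 ∈ Subgroup.center L) :
    x * (x * (x * y * x⁻¹) * x⁻¹) * x⁻¹ = y := by
  have e : x * (x * (x * y * x⁻¹) * x⁻¹) * x⁻¹ = x ^ 3 * y * (x ^ 3)⁻¹ := by
    simp only [pow_succ, pow_zero, one_mul, mul_inv_rev, mul_assoc]
  rw [e, ← Subgroup.mem_center_iff.1 hA y, mul_inv_cancel_right]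

theorem commutation_conj {z u v : L} (hz : z ∈ Subgroup.center L) (x : L)
    (h : u * v = z * (v * u)) :
    (x * u * x⁻¹) * (x * v * x⁻¹) = z * ((x * v * x⁻¹) * (x * u * x⁻¹)) := by
  rw [conj_mul, h, conj_mul, ← mul_assoc x, Subgroup.mem_center_iff.1 hz, mul_assoc z, mul_assoc z]

theorem relB_commutation (x y : L) :
    (x * y * x⁻¹) * y = relB x y * (y * (x * y * x⁻¹)) := by
  simp [relB, mul_assoc]

/-- Moving c past both sides of c⁻⁴b² = wa gives z² on the left, from b², and z⁻¹ on the right, from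
a. Hence z² = z⁻¹. -/
theorem pow_three_eq_one_of_commutation {z w a b c : L} (hz : z ∈ Subgroup.center L)
    (hw : w ∈ Subgroup.center L) (hcb : c * b = z * (b * c)) (hac : a * c = z * (c * a))
    (h : (c ^ 4)⁻¹ * b ^ 2 = w * a) : z ^ 3 = 1 := by
  have hz' := Subgroup.mem_center_iff.1 hz
  have hw' := Subgroup.mem_center_iff.1 hw
  have h2 : c * b ^ 2 = z ^ 2 * (b ^ 2 * c) := by
    calc c * b ^ 2 = (c * b) * b := by rw [pow_two, mul_assoc]
      _ = z * (b * c) * b := by rw [hcb]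
      _ = z * (b * (c * b)) := by simp only [mul_assoc]
      _ = z * ((b * z) * (b * c)) := by rw [hcb, mul_assoc b z]
      _ = z ^ 2 * (b ^ 2 * c) := by rw [hz']; simp only [pow_two, mul_assoc]
  have h3 : c * (w * a) = z ^ 2 * ((w * a) * c) := by
    rw [← h]
    calc c * ((c ^ 4)⁻¹ * b ^ 2) = (c ^ 4)⁻¹ * (c * b ^ 2) := by
          rw [← mul_assoc, ← mul_assoc, ((Commute.refl c).pow_right 4).inv_right.eq]
      _ = (c ^ 4)⁻¹ * z ^ 2 * (b ^ 2 * c) := by rw [h2, mul_assoc]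
      _ = z ^ 2 * ((c ^ 4)⁻¹ * b ^ 2 * c) := by
          rw [Subgroup.mem_center_iff.1 (pow_mem hz 2)]; simp only [mul_assoc]
  have h4 : w * (c * a) = w * (z ^ 3 * (c * a)) := by
    calc w * (c * a) = c * (w * a) := by rw [← mul_assoc, ← mul_assoc, hw']
      _ = z ^ 2 * w * (a * c) := by rw [h3]; simp only [mul_assoc]
      _ = w * (z ^ 3 * (c * a)) := by rw [hw', hac, pow_succ z 2]; simp only [mul_assoc]
  exact (mul_eq_right.1 (mul_left_cancel h4).symm)

/-- If the relators are central, then the second one has order dividing `3`. -/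
theorem relB_pow_three {x y : L} (hA : x ^ 3 ∈ Subgroup.center L)
    (hB : relB x y ∈ Subgroup.center L) (hC : relC x y ∈ Subgroup.center L) :
    relB x y ^ 3 = 1 := by
  have h21 := commutation_conj hB x (relB_commutation x y)
  have h02 := commutation_conj hB x h21
  rw [conj_conj_conj hA] at h02
  exact pow_three_eq_one_of_commutation hB (mul_mem hA hC) h21 h02 (relC_eq x y)

theorem zpow_emod_eq {L : Type} [Group L] {a : L} {n : ℕ} (h : a ^ n = 1) (k : ℤ) :
    a ^ (k % n) = a ^ k := by
  rw [Int.emod_def, zpow_sub, zpow_mul, zpow_natCast, h, one_zpow, inv_one, mul_one]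

/-- The normal form `b ^ i * c ^ j * x ^ k` for elements of the presented group. -/
theorem exists_normal_form {x a b c : L} (hgen : Subgroup.closure {x, a} = ⊤)
    (hab : Commute b c) (hxb : x * b * x⁻¹ = c) (hxa : x * a * x⁻¹ = b) (hxc : x * c * x⁻¹ = a)
    (ha : a = b ^ (2 : ℤ) * c ^ (-4 : ℤ)) (g : L) :
    ∃ i j k : ℤ, g = b ^ i * c ^ j * x ^ k := by
  have hapow (n : ℤ) : a ^ n = b ^ (2 * n) * c ^ (-4 * n) := by
    rw [ha, (hab.zpow_zpow _ _).mul_zpow, zpow_mul, zpow_mul]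
  have hmul (i j i' j' : ℤ) : (b ^ i * c ^ j) * (b ^ i' * c ^ j') = b ^ (i + i') * c ^ (j + j') := by
    rw [zpow_add, zpow_add, mul_assoc, ← mul_assoc (c ^ j), ((hab.zpow_zpow i' j).eq).symm]
    simp only [mul_assoc]
  have hg : g ∈ Subgroup.closure {x, a} := hgen ▸ Subgroup.mem_top g
  induction hg using Subgroup.closure_induction_left with
  | one => exact ⟨0, 0, 0, by simp⟩
  | mul_left s hs g _ ih =>
    obtain ⟨i, j, k, rfl⟩ := ih
    rcases hs with rfl | rfl
    -- Conjugation by x turns b^i c^j into c^i a^j, and a^j = b^(2j) c^(-4j).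
    · refine ⟨2 * j, i + -4 * j, k + 1, ?_⟩
      have : s * (b ^ i * c ^ j * s ^ k) = (s * b * s⁻¹) ^ i * (s * c * s⁻¹) ^ j * s ^ (k + 1) := by
        rw [conj_zpow, conj_zpow, add_comm, zpow_one_add]
        simp only [mul_assoc, inv_mul_cancel_left]
      rw [this, hxb, hxc, hapow, ← mul_assoc, (hab.zpow_zpow _ _).symm.eq, mul_assoc (b ^ _),
        ← zpow_add]
    · refine ⟨2 + i, -4 + j, k, ?_⟩
      rw [← mul_assoc, ha, hmul]
  | inv_mul_cancel s hs g _ ih =>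
    obtain ⟨i, j, k, rfl⟩ := ih
    rcases hs with rfl | rfl
    -- Conjugation by x⁻¹ turns b^i c^j into a^i b^j.
    · refine ⟨2 * i + j, -4 * i, k - 1, ?_⟩
      have : s * (a ^ i * b ^ j * s ^ (k - 1)) =
          (s * a * s⁻¹) ^ i * (s * b * s⁻¹) ^ j * s ^ k := by
        rw [conj_zpow, conj_zpow, show s ^ k = s * s ^ (k - 1) by rw [← zpow_one_add]; congr 1; ring]
        simp only [mul_assoc, inv_mul_cancel_left]
      rw [inv_mul_eq_iff_eq_mul, show b ^ (2 * i + j) * c ^ (-4 * i) = a ^ i * b ^ j by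
        rw [hapow, mul_assoc, ← (hab.zpow_zpow _ _).eq, ← mul_assoc, ← zpow_add], this, hxa, hxb]
    · refine ⟨-2 + i, 4 + j, k, ?_⟩
      rw [inv_mul_eq_iff_eq_mul, ← mul_assoc s, ha, hmul]
      congr 3 <;> ring

/-- A group generated by two elements satisfying the relators of `presP` has at most `243`
elements. -/
theorem finite_and_card_le {x y : L} (hgen : Subgroup.closure {x, y} = ⊤) (hA : x ^ 3 = 1)
    (hB : relB x y = 1) (hC : relC x y = 1) : Finite L ∧ Nat.card L ≤ 243 := by
  set b := x * y * x⁻¹ with hb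
  set c := x * b * x⁻¹ with hc
  have hxc : x * c * x⁻¹ = y := conj_conj_conj (hA ▸ one_mem _)
  have hby : Commute b y := by
    have := relB_commutation x y
    rwa [hB, one_mul] at this
  have hconj {u v : L} (h : Commute u v) : Commute (x * u * x⁻¹) (x * v * x⁻¹) := by
    have := commutation_conj (one_mem _) x (h.eq.trans (one_mul _).symm)
    rwa [one_mul] at this
  have hcb : Commute c b := hconj hby
  have hy : y = b ^ (2 : ℤ) * c ^ (-4 : ℤ) := by
    have := relC_eq x y
    rw [hA, hC, one_mul, one_mul] at this
    rw [← hb, ← hc] at this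
    rw [zpow_neg, (hcb.symm.zpow_zpow 2 4).inv_right.eq]
    exact_mod_cast this.symm
  have hb' : b = c ^ (2 : ℤ) * y ^ (-4 : ℤ) := by
    have := congrArg (fun g => x * g * x⁻¹) hy
    simpa only [← conj_mul, ← conj_zpow, ← hb, ← hc, hxc] using this
  have hc' : c = y ^ (2 : ℤ) * b ^ (-4 : ℤ) := by
    have := congrArg (fun g => x * g * x⁻¹) hb'
    simpa only [← conj_mul, ← conj_zpow, ← hb, ← hc, hxc] using this
  have hypow (n : ℤ) : y ^ n = b ^ (2 * n) * c ^ (-4 * n) := by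
    rw [hy, (hcb.symm.zpow_zpow _ _).mul_zpow, zpow_mul, zpow_mul]
  -- Substituting y² = b⁴c⁻⁸ into c = y²b⁻⁴ leaves c = c⁻⁸.
  have hc9 : c ^ 9 = 1 := by
    rw [hypow, mul_assoc, (hcb.zpow_zpow _ _).eq, ← mul_assoc, ← zpow_add] at hc'
    norm_num at hc'
    have : c ^ (9 : ℤ) = c * (c ^ (8 : ℤ)) := by rw [← zpow_one_add]; norm_num
    rw [← zpow_natCast]
    push_cast
    rw [this]
    nth_rw 1 [hc']
    simp
  have hb9 : b ^ 9 = 1 := by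
    have := congrArg (fun g => x⁻¹ * g * x) hc9
    rw [hc, conj_pow] at this
    simpa [mul_assoc] using this
  let f : ZMod 9 × ZMod 9 × ZMod 3 → L := fun t =>
    b ^ (t.1.cast : ℤ) * c ^ (t.2.1.cast : ℤ) * x ^ (t.2.2.cast : ℤ)
  have hf : Function.Surjective f := fun g => by
    obtain ⟨i, j, k, rfl⟩ := exists_normal_form hgen hcb.symm hc.symm hb.symm hxc hy g
    refine ⟨(i, j, k), ?_⟩
    simp only [f, ZMod.coe_intCast, zpow_emod_eq hb9, zpow_emod_eq hc9, zpow_emod_eq hA]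
  have hcard : Nat.card (ZMod 9 × ZMod 9 × ZMod 3) = 243 := by simp
  exact ⟨Finite.of_surjective f hf, hcard ▸ Nat.card_le_card_of_surjective f hf⟩

end Relations

end BingGroups

namespace BingGroups

/-! ### The covering group of order 729. -/

section Model

/-- Reduction modulo `3`. -/
abbrev red : ZMod 9 →+* ZMod 3 := ZMod.castHom (by norm_num) (ZMod 3)

/-- The Heisenberg type group of triples `(a, b, c)`, standing for `u ^ a * v ^ b * z ^ c` where
`u ^ 9 = v ^ 9 = z ^ 3 = 1`, `z` is central and `v * u = z * u * v`. -/
@[ext] structure Heis where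
  /-- exponent of `u` -/
  a : ZMod 9
  /-- exponent of `v` -/
  b : ZMod 9
  /-- exponent of `z` -/
  c : ZMod 3
deriving DecidableEq

namespace Heis

instance : Mul Heis := ⟨fun p q => ⟨p.a + q.a, p.b + q.b, p.c + q.c + red p.b * red q.a⟩⟩
instance : One Heis := ⟨⟨0, 0, 0⟩⟩
instance : Inv Heis := ⟨fun p => ⟨-p.a, -p.b, -p.c + red p.b * red p.a⟩⟩

@[simp] theorem mul_a (p q : Heis) : (p * q).a = p.a + q.a := rfl
@[simp] theorem mul_b (p q : Heis) : (p * q).b = p.b + q.b := rfl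
@[simp] theorem mul_c (p q : Heis) : (p * q).c = p.c + q.c + red p.b * red q.a := rfl
@[simp] theorem one_a : (1 : Heis).a = 0 := rfl
@[simp] theorem one_b : (1 : Heis).b = 0 := rfl
@[simp] theorem one_c : (1 : Heis).c = 0 := rfl
@[simp] theorem inv_a (p : Heis) : p⁻¹.a = -p.a := rfl
@[simp] theorem inv_b (p : Heis) : p⁻¹.b = -p.b := rfl
@[simp] theorem inv_c (p : Heis) : p⁻¹.c = -p.c + red p.b * red p.a := rfl

instance : Group Heis :=
  Group.ofLeftAxioms
    (fun p q r => by
      ext1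
      · simp [add_assoc]
      · simp [add_assoc]
      · simp only [mul_c, mul_a, mul_b, map_add]; ring)
    (fun p => by ext1 <;> simp)
    (fun p => by
      ext1
      · simp
      · simp
      · simp only [mul_c, inv_c, inv_b, one_c, map_neg]; ring)

/-- Heis as a product. -/
def equivProd : Heis ≃ ZMod 9 × ZMod 9 × ZMod 3 where
  toFun p := (p.a, p.b, p.c)
  invFun t := ⟨t.1, t.2.1, t.2.2⟩
  left_inv _ := rfl
  right_inv _ := rfl

theorem card_eq : Nat.card Heis = 243 := by
  rw [Nat.card_congr equivProd]; simp

/-- The endomorphism `u ↦ v`, `v ↦ v ^ (-4) * u ^ 2`, `z ↦ z`. -/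
def rotHom : Heis →* Heis :=
  MonoidHom.mk' (fun p => ⟨2 * p.b, p.a - 4 * p.b,
    p.c - red p.a * red p.b - red p.b ^ 2 - red p.b⟩) <| by
    intro p q
    ext1
    · simp only [mul_a, mul_b]; ring
    · simp only [mul_a, mul_b]; ring
    · have h4 : (4 : ZMod 3) = 1 := rfl
      have h3 : (3 : ZMod 3) = 0 := rfl
      simp only [mul_a, mul_b, mul_c, map_add, map_sub, map_mul, map_ofNat, h4]
      linear_combination (-red p.a * red q.b) * h3

@[simp] theorem rotHom_a (p : Heis) : (rotHom p).a = 2 * p.b := rfl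
@[simp] theorem rotHom_b (p : Heis) : (rotHom p).b = p.a - 4 * p.b := rfl
@[simp] theorem rotHom_c (p : Heis) :
    (rotHom p).c = p.c - red p.a * red p.b - red p.b ^ 2 - red p.b := rfl

/-- On the exponents (a, b) the map is the matrix with rows (0, 2) and (1, -4), whose cube is the
identity modulo 9. -/
theorem rotHom_rotHom_rotHom (p : Heis) : rotHom (rotHom (rotHom p)) = p := by
  have h9 : (9 : ZMod 9) = 0 := rfl
  have h3 : (3 : ZMod 3) = 0 := rfl
  have h2 : (2 : ZMod 3) = -1 := rfl
  have h4 : (4 : ZMod 3) = 1 := rfl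
  ext1
  · simp only [rotHom_a, rotHom_b]
    linear_combination (- p.a + 4 * p.b) * h9
  · simp only [rotHom_a, rotHom_b]
    linear_combination (2 * p.a - 9 * p.b) * h9
  · simp only [rotHom_a, rotHom_b, rotHom_c, map_sub, map_mul, map_ofNat, h2, h4]
    generalize red p.a = s, red p.b = t, p.c = c
    revert s t c
    decide

/-- The automorphism `rotHom` of order three. -/
def rot : MulAut Heis where
  toFun := rotHom
  invFun p := rotHom (rotHom p)
  left_inv := rotHom_rotHom_rotHom
  right_inv := rotHom_rotHom_rotHom
  map_mul' := map_mul rotHom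

theorem rot_pow_three : rot ^ 3 = 1 := MulEquiv.ext rotHom_rotHom_rotHom

/-- The action of the cyclic group of order `3` by powers of `rot`. -/
def rotAct : Multiplicative (ZMod 3) →* MulAut Heis :=
  MonoidHom.mk' (fun k => rot ^ k.toAdd.val) fun k l => by
    rw [toAdd_mul, ZMod.val_add, ← pow_add]
    conv_rhs => rw [← Nat.mod_add_div (k.toAdd.val + l.toAdd.val) 3, pow_add, pow_mul,
      rot_pow_three, one_pow, mul_one]

end Heis

/-- The covering group of order `729`. -/
abbrev Cover : Type := Heis ⋊[Heis.rotAct] Multiplicative (ZMod 3)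

theorem card_cover : Nat.card Cover = 729 := by
  rw [SemidirectProduct.card, Heis.card_eq]; simp

namespace Cover

/-- The first generator. -/
def x : Cover := ⟨1, Multiplicative.ofAdd 1⟩
/-- The second generator. -/
def y : Cover := ⟨⟨1, 0, 0⟩, 1⟩
/-- The central element of order three. -/
def z : Cover := ⟨⟨0, 0, 1⟩, 1⟩

theorem x_pow : x ^ 3 = 1 := by decide
theorem relB_x_y : relB x y = z := by decide
theorem relC_x_y : relC x y = 1 := by decide
theorem z_ne_one : z ≠ 1 := by decide
theorem z_pow : z ^ 3 = 1 := by decide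

end Cover
end Model
end BingGroups

namespace BingGroups

/-! ### Values of the second relator in the covering group. -/

section Model

namespace Heis

theorem rotAct_one (p : Heis) : rotAct (Multiplicative.ofAdd 1) p = rotHom p := rfl
theorem rotAct_two (p : Heis) : rotAct (Multiplicative.ofAdd 2) p = rotHom (rotHom p) := rfl

theorem ofAdd_cases (k : Multiplicative (ZMod 3)) :
    k = 1 ∨ k = Multiplicative.ofAdd 1 ∨ k = Multiplicative.ofAdd 2 := by
  revert k; decide

theorem inv_ofAdd_two : (Multiplicative.ofAdd (2 : ZMod 3))⁻¹ = Multiplicative.ofAdd 1 := by decide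

/-- If v is fixed by the rotation modulo z, then its exponents a and b are divisible by 3, because 1
- `rotHom` has determinant 3 on (a, b). Such a v is central in `Heis`, and its z-coordinate is
unchanged by the rotation, so nothing is left. -/
theorem commutator_rot_eq_one (v m : Heis) (ha : (v * (m * rotHom v⁻¹ * m⁻¹)).a = 0)
    (hb : (v * (m * rotHom v⁻¹ * m⁻¹)).b = 0) : v * (m * rotHom v⁻¹ * m⁻¹) = 1 := by
  have key : ∀ a b : ZMod 9, a - 2 * b = 0 → 5 * b - a = 0 → red a = 0 ∧ red b = 0 := by decide
  obtain ⟨h1, h2⟩ := key v.a v.b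
    (by simp only [mul_a, rotHom_a, inv_a, inv_b] at ha; linear_combination ha)
    (by simp only [mul_b, rotHom_b, inv_a, inv_b] at hb; linear_combination hb)
  ext1
  · exact ha
  · exact hb
  · simp only [mul_a, mul_b, mul_c, inv_a, inv_b, inv_c, rotHom_a, rotHom_b, rotHom_c, one_c,
      map_add, map_sub, map_mul, map_neg, map_ofNat, h1, h2]
    ring

theorem commutator_rot_rot_eq_one (v m : Heis)
    (ha : (v * (m * rotHom (rotHom v⁻¹) * m⁻¹)).a = 0)
    (hb : (v * (m * rotHom (rotHom v⁻¹) * m⁻¹)).b = 0) :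
    v * (m * rotHom (rotHom v⁻¹) * m⁻¹) = 1 := by
  have key : ∀ a b : ZMod 9, a - 2 * a + 8 * b = 0 → b - 2 * b + 4 * (a - 4 * b) = 0 →
    red a = 0 ∧ red b = 0 := by decide
  obtain ⟨h1, h2⟩ := key v.a v.b
    (by simp only [mul_a, rotHom_a, rotHom_b, inv_a, inv_b] at ha; linear_combination ha)
    (by simp only [mul_b, rotHom_a, rotHom_b, inv_a, inv_b] at hb; linear_combination hb)
  ext1
  · exact ha
  · exact hb
  · simp only [mul_a, mul_b, mul_c, inv_a, inv_b, inv_c, rotHom_a, rotHom_b, rotHom_c, one_c,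
      map_add, map_sub, map_mul, map_neg, map_ofNat, h1, h2]
    ring

theorem commutator_a (u m : Heis) : (u * m * u⁻¹ * m⁻¹).a = 0 := by
  simp only [mul_a, inv_a]; ring

theorem commutator_b (u m : Heis) : (u * m * u⁻¹ * m⁻¹).b = 0 := by
  simp only [mul_b, inv_b]; ring

/-- Commutators in `Heis` are given by an alternating form on exponents modulo 3. -/
theorem commutator_c (u m : Heis) :
    (u * m * u⁻¹ * m⁻¹).c = red u.b * red m.a - red m.b * red u.a := by
  simp only [mul_c, inv_c, mul_b, inv_a, inv_b, map_add, map_neg]; ring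

end Heis

namespace Cover

open Heis

theorem z_mem_center : z ∈ Subgroup.center Cover := by
  rw [Subgroup.mem_center_iff]
  rintro ⟨n, k⟩
  have h (k) : rotAct k ⟨0, 0, 1⟩ = ⟨0, 0, 1⟩ := by revert k; decide
  have h1 : n * ⟨0, 0, 1⟩ = ⟨0, 0, 1⟩ * n := by ext1 <;> simp [add_comm]
  apply SemidirectProduct.ext
  · simpa [z, h] using h1
  · simp [z]

theorem mem_zpowers_z {g : Cover} :
    g ∈ Subgroup.zpowers z ↔ g.left.a = 0 ∧ g.left.b = 0 ∧ g.right = 1 := by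
  constructor
  · rintro ⟨n, rfl⟩
    have h0 := Int.emod_nonneg n (by norm_num : (3 : ℤ) ≠ 0)
    have h1 := Int.emod_lt_of_pos n (by norm_num : (0 : ℤ) < 3)
    have h2 : z ^ (n % 3) = z ^ n := zpow_emod_eq z_pow n
    change (z ^ n).left.a = 0 ∧ (z ^ n).left.b = 0 ∧ (z ^ n).right = 1
    rw [← h2]
    generalize n % 3 = k at *
    interval_cases k <;> decide
  · rintro ⟨ha, hb, hk⟩
    obtain ⟨⟨a, b, c⟩, k⟩ := g
    obtain rfl : a = 0 := ha
    obtain rfl : b = 0 := hb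
    obtain rfl : k = 1 := hk
    have : ∀ c : ZMod 3, (⟨⟨0, 0, c⟩, 1⟩ : Cover) = z ^ c.val := by decide
    rw [this]
    exact pow_mem (Subgroup.mem_zpowers z) _

/-- With h = m in `Heis` and g acting through `rot ^ i`, the relator is the commutator of a
conjugate of rot^i(m) with m. Writing (s, t) for the exponents of m modulo 3, the power of z is 0,
(s + t)² or -(s + t)² for i = 0, 1, 2. The last case needs the other relators to give s + t = 0. -/
theorem relB_eq_one_or_of_right {g h : Cover} (hh : h.right = 1)
    (hA : g ^ 3 ∈ Subgroup.zpowers z) (hC : relC g h ∈ Subgroup.zpowers z) :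
    relB g h = 1 ∨ relB g h = z := by
  obtain ⟨m, k⟩ := h
  obtain rfl : k = 1 := hh
  obtain ⟨n, i⟩ := g
  have hl : (relB (⟨n, i⟩ : Cover) ⟨m, 1⟩) = ⟨(n * rotAct i m * n⁻¹) * m *
      (n * rotAct i m * n⁻¹)⁻¹ * m⁻¹, 1⟩ := by
    have e : relB (⟨n, i⟩ : Cover) ⟨m, 1⟩ = (⟨n, i⟩ * ⟨m, 1⟩ * (⟨n, i⟩ : Cover)⁻¹) * ⟨m, 1⟩ *
      (⟨n, i⟩ * ⟨m, 1⟩ * (⟨n, i⟩ : Cover)⁻¹)⁻¹ * (⟨m, 1⟩ : Cover)⁻¹ := by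
      simp [relB, mul_assoc]
    have e2 : ⟨n, i⟩ * ⟨m, 1⟩ * (⟨n, i⟩ : Cover)⁻¹ = ⟨n * rotAct i m * n⁻¹, 1⟩ := by
      apply SemidirectProduct.ext <;> simp
    rw [e, e2]
    apply SemidirectProduct.ext <;> simp
  rw [hl]
  have key (t : ZMod 3) (ht : (n * rotAct i m * n⁻¹ * m * (n * rotAct i m * n⁻¹)⁻¹ * m⁻¹).c = t)
      (ht' : t = 0 ∨ t = 1) :
      (⟨n * rotAct i m * n⁻¹ * m * (n * rotAct i m * n⁻¹)⁻¹ * m⁻¹, 1⟩ : Cover) = 1 ∨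
      (⟨n * rotAct i m * n⁻¹ * m * (n * rotAct i m * n⁻¹)⁻¹ * m⁻¹, 1⟩ : Cover) = z := by
    have : n * rotAct i m * n⁻¹ * m * (n * rotAct i m * n⁻¹)⁻¹ * m⁻¹ = ⟨0, 0, t⟩ :=
      Heis.ext (commutator_a _ _) (commutator_b _ _) ht
    rw [this]
    rcases ht' with rfl | rfl
    · exact Or.inl rfl
    · exact Or.inr rfl
  refine key _ (commutator_c _ _) ?_
  simp only [mul_a, mul_b, inv_a, inv_b, map_add, map_neg]
  rcases ofAdd_cases i with rfl | rfl | rfl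
  · left
    simp only [map_one, MulAut.one_apply]
    ring
  -- The exponent is s² - st + t² = (s + t)² modulo 3, so it is 0 or 1.
  · simp only [rotAct_one, rotHom_a, rotHom_b, map_sub, map_mul, map_ofNat]
    generalize red m.a = s, red m.b = t, red n.a = s', red n.b = t'
    revert s t s' t'
    decide
  · left
    rw [mem_zpowers_z] at hA hC
    have hA1 := hA.1
    have hC1 := hC.1
    simp only [pow_succ, pow_zero, one_mul, SemidirectProduct.mul_left, SemidirectProduct.mul_right,
      rotAct_two, rotAct_one, mul_a, rotHom_a, rotHom_b, ← ofAdd_add,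
      show (2 + 2 : ZMod 3) = 1 from rfl] at hA1
    simp [relC, pow_succ, rotAct_one, inv_ofAdd_two] at hC1
    have h9 : (9 : ZMod 9) = 0 := rfl
    -- Modulo 9, the first coordinate of g³ is 3(n.a + n.b), and that of the third relator is 3(m.a
    -- + m.b) minus this.
    have h3 : 3 * (m.a + m.b) = 0 := by
      linear_combination hC1 - 2 * hA1 + (-m.a + 7 * m.b + 2 * n.b) * h9
    have hred : ∀ a b : ZMod 9, 3 * (a + b) = 0 → red a + red b = 0 := by decide
    have hst := hred _ _ h3
    simp only [rotAct_two, rotHom_a, rotHom_b, map_sub, map_mul, map_ofNat]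
    generalize red m.a = s, red m.b = t, red n.a = s', red n.b = t' at *
    clear * - hst
    revert s t s' t'
    decide

/-- The relator is also the commutator of [g, h] with h. Here [g, h] lies in `Heis` and h acts by a
nontrivial rotation, so the fixed-point lemmas above apply. -/
theorem relB_eq_one_of_right {g h : Cover} (hh : h.right ≠ 1)
    (hB : relB g h ∈ Subgroup.zpowers z) : relB g h = 1 := by
  set c := g * h * g⁻¹ * h⁻¹ with hc
  have e : relB g h = c * (h * c⁻¹ * h⁻¹) := by simp [relB, hc, mul_assoc]
  have hcr : c.right = 1 := by simp [hc]
  rw [e] at hB ⊢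
  clear_value c
  obtain ⟨v, k⟩ := c
  obtain rfl : k = 1 := hcr
  obtain ⟨m, j⟩ := h
  have e2 : (⟨v, 1⟩ : Cover) * (⟨m, j⟩ * (⟨v, 1⟩ : Cover)⁻¹ * (⟨m, j⟩ : Cover)⁻¹) =
      ⟨v * (m * rotAct j v⁻¹ * m⁻¹), 1⟩ := by
    apply SemidirectProduct.ext <;> simp
  rw [e2, mem_zpowers_z] at hB
  rw [e2]
  obtain ⟨ha, hb, -⟩ := hB
  rcases ofAdd_cases j with rfl | rfl | rfl
  · exact absurd rfl hh
  · exact SemidirectProduct.ext (commutator_rot_eq_one v m ha hb) rfl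
  · exact SemidirectProduct.ext (commutator_rot_rot_eq_one v m ha hb) rfl

/-- A pair of elements satisfying the relators modulo `z` has second relator `1` or `z`. -/
theorem relB_eq_one_or {g h : Cover} (hA : g ^ 3 ∈ Subgroup.zpowers z)
    (hB : relB g h ∈ Subgroup.zpowers z) (hC : relC g h ∈ Subgroup.zpowers z) :
    relB g h = 1 ∨ relB g h = z := by
  by_cases hh : h.right = 1
  · exact relB_eq_one_or_of_right hh hA hC
  · exact Or.inl (relB_eq_one_of_right hh hB)

theorem closure_x_y : Subgroup.closure {x, y} = ⊤ := by
  have hx : x ∈ Subgroup.closure {x, y} := Subgroup.subset_closure (by simp)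
  have hy : y ∈ Subgroup.closure {x, y} := Subgroup.subset_closure (by simp)
  have hz : z ∈ Subgroup.closure {x, y} := by
    rw [← relB_x_y, relB]
    apply_rules [mul_mem, inv_mem]
  rw [eq_top_iff]
  rintro ⟨⟨a, b, c⟩, k⟩ -
  have h1 : ∀ a : ZMod 9, (⟨⟨a, 0, 0⟩, 1⟩ : Cover) = y ^ a.val := by decide
  have h2 : ∀ b : ZMod 9, (⟨⟨0, b, 0⟩, 1⟩ : Cover) = (x * y * x⁻¹) ^ b.val := by decide
  have h3 : ∀ c : ZMod 3, (⟨⟨0, 0, c⟩, 1⟩ : Cover) = z ^ c.val := by decide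
  have h4 : ∀ k : Multiplicative (ZMod 3), (⟨1, k⟩ : Cover) = x ^ k.toAdd.val := by decide
  have : (⟨⟨a, b, c⟩, k⟩ : Cover) =
      ⟨⟨a, 0, 0⟩, 1⟩ * ⟨⟨0, b, 0⟩, 1⟩ * ⟨⟨0, 0, c⟩, 1⟩ * ⟨1, k⟩ := by
    apply SemidirectProduct.ext
    · ext1 <;> simp
    · simp
  rw [this, h1, h2, h3, h4]
  apply_rules [mul_mem, inv_mem, pow_mem]

end Cover
end Model
end BingGroups

namespace BingGroups

open scoped IsMulCommutative

/-! ### Identification of the presented group with the quotient of the cover. -/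

section Presented

/-- The relator is the commutator [xyx⁻¹, y], in which central factors cancel. Its value in a
central extension is therefore independent of the lifts of x and y. -/
theorem relB_mul_center {L : Type} [Group L] {u v : L} (hu : u ∈ Subgroup.center L)
    (hv : v ∈ Subgroup.center L) (x y : L) : relB (u * x) (v * y) = relB x y := by
  have hu' := Subgroup.mem_center_iff.1 hu
  have hv' := Subgroup.mem_center_iff.1 hv
  have hrel (s t : L) : relB s t = (s * t * s⁻¹) * t * (s * t * s⁻¹)⁻¹ * t⁻¹ := by
    simp [relB, mul_assoc]
  have h1 : u * x * (v * y) * (u * x)⁻¹ = v * (x * y * x⁻¹) := by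
    rw [mul_inv_eq_iff_eq_mul, ← hu', ← mul_assoc (x * u), hv' (x * u), mul_assoc v, mul_assoc v]
    congr 1
    rw [mul_assoc x u y, ← hu' y]
    simp only [mul_assoc, inv_mul_cancel_left]
  have h2 (b : L) : v * b * (v * y) * (v * b)⁻¹ * (v * y)⁻¹ = b * y * b⁻¹ * y⁻¹ := by
    rw [mul_inv_eq_iff_eq_mul, mul_inv_eq_iff_eq_mul, ← hv' b, ← hv' y, mul_assoc b v,
      ← mul_assoc v y, ← hv' y]
    have e : b * y * b⁻¹ * y⁻¹ * (y * v) * (b * v) = b * y * b⁻¹ * (v * b) * v := by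
      simp only [mul_assoc, inv_mul_cancel_left]
    rw [e, ← hv' b]
    simp only [mul_assoc, inv_mul_cancel_left]
  rw [hrel, h1, h2, hrel]

/-- The presented group. -/
abbrev GrpP : Type := presP.PresGroup

/-- The relators of `presP`, with explicit index types. -/
def relP : Fin 3 → FreeGroup (Fin 2) := presP.rel

/-- The projection from the free group. -/
def freeProj : FreeGroup (Fin 2) →* GrpP := PresentedGroup.mk (Set.range relP)

theorem freeProj_surjective : Function.Surjective freeProj := PresentedGroup.mk_surjective _

theorem freeProj_eq_one_iff (w : FreeGroup (Fin 2)) :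
    freeProj w = 1 ↔ w ∈ Subgroup.normalClosure (Set.range relP) :=
  PresentedGroup.mk_eq_one_iff

/-- The first generator. -/
def genX : GrpP := freeProj (FreeGroup.of 0)

/-- The second generator. -/
def genY : GrpP := freeProj (FreeGroup.of 1)

theorem rel_zero : relP 0 = (FreeGroup.of 0 : FreeGroup (Fin 2)) ^ 3 := rfl
theorem rel_one :
    relP 1 = relB (FreeGroup.of 0 : FreeGroup (Fin 2)) (FreeGroup.of 1) := rfl
theorem rel_two :
    relP 2 = relC (FreeGroup.of 0 : FreeGroup (Fin 2)) (FreeGroup.of 1) := rfl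

theorem freeProj_rel (i : Fin 3) : freeProj (relP i) = 1 :=
  (freeProj_eq_one_iff _).2 (Subgroup.subset_normalClosure ⟨i, rfl⟩)

theorem genX_pow : genX ^ 3 = 1 := by
  rw [genX, ← map_pow, ← rel_zero, freeProj_rel]

theorem relB_gen : relB genX genY = 1 := by
  rw [genX, genY, ← map_relB, ← rel_one, freeProj_rel]

theorem relC_gen : relC genX genY = 1 := by
  rw [genX, genY, ← map_relC, ← rel_two, freeProj_rel]

theorem closure_gen : Subgroup.closure {genX, genY} = ⊤ := by
  have h := congrArg (Subgroup.map freeProj) (FreeGroup.closure_range_of (Fin 2))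
  rw [MonoidHom.map_closure, Subgroup.map_top_of_surjective _ freeProj_surjective] at h
  rw [← h]
  congr 1
  ext g
  simp [genX, genY, eq_comm]

instance finite_grpP : Finite GrpP :=
  (finite_and_card_le closure_gen genX_pow relB_gen relC_gen).1

theorem card_grpP_le : Nat.card GrpP ≤ 243 :=
  (finite_and_card_le closure_gen genX_pow relB_gen relC_gen).2

instance zpowers_z_normal : (Subgroup.zpowers Cover.z).Normal :=
  ⟨fun g hg a => by
    have : g ∈ Subgroup.center Cover :=
      (Subgroup.zpowers_le.2 Cover.z_mem_center) hg
    rwa [Subgroup.mem_center_iff.1 this a, mul_inv_cancel_right]⟩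

/-- The model of the presented group. -/
abbrev CoverQuot : Type := Cover ⧸ Subgroup.zpowers Cover.z

theorem card_coverQuot : Nat.card CoverQuot = 243 := by
  have h := Subgroup.card_eq_card_quotient_mul_card_subgroup (Subgroup.zpowers Cover.z)
  rw [card_cover, Nat.card_zpowers, orderOf_eq_prime Cover.z_pow Cover.z_ne_one] at h
  change 729 = Nat.card CoverQuot * 3 at h
  omega

/-- The projection from the covering group to the model. -/
def coverMk : Cover →* CoverQuot := QuotientGroup.mk' _

theorem coverMk_eq_one_iff (g : Cover) : coverMk g = 1 ↔ g ∈ Subgroup.zpowers Cover.z :=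
  QuotientGroup.eq_one_iff g

theorem coverMk_surjective : Function.Surjective coverMk := QuotientGroup.mk'_surjective _

theorem exists_toQuot : ∃ f : GrpP →* CoverQuot, f genX = coverMk Cover.x ∧
    f genY = coverMk Cover.y := by
  have h : ∀ r ∈ Set.range relP,
      FreeGroup.lift (![coverMk Cover.x, coverMk Cover.y] : Fin 2 → CoverQuot) r = 1 := by
    rintro _ ⟨i, rfl⟩
    fin_cases i
    · change FreeGroup.lift _ (relP 0) = 1
      rw [rel_zero, map_pow, FreeGroup.lift_apply_of, Matrix.cons_val_zero, ← map_pow, Cover.x_pow,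
        map_one]
    · change FreeGroup.lift _ (relP 1) = 1
      rw [rel_one, map_relB, FreeGroup.lift_apply_of, FreeGroup.lift_apply_of]
      change relB (coverMk Cover.x) (coverMk Cover.y) = 1
      rw [← map_relB, Cover.relB_x_y, coverMk_eq_one_iff]
      exact Subgroup.mem_zpowers _
    · change FreeGroup.lift _ (relP 2) = 1
      rw [rel_two, map_relC, FreeGroup.lift_apply_of, FreeGroup.lift_apply_of]
      change relC (coverMk Cover.x) (coverMk Cover.y) = 1
      rw [← map_relC, Cover.relC_x_y, map_one]
  exact ⟨PresentedGroup.toGroup h, PresentedGroup.toGroup.of h, PresentedGroup.toGroup.of h⟩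

/-- A surjection from a group with at most 243 elements onto one with exactly 243 is bijective. -/
theorem exists_equiv : ∃ e : GrpP ≃* CoverQuot, e genX = coverMk Cover.x ∧
    e genY = coverMk Cover.y := by
  obtain ⟨f, hx, hy⟩ := exists_toQuot
  have hsurj : Function.Surjective f := by
    rw [← MonoidHom.range_eq_top, eq_top_iff,
      ← Subgroup.map_top_of_surjective _ coverMk_surjective, ← Cover.closure_x_y,
      MonoidHom.map_closure, Subgroup.closure_le]
    rintro _ ⟨g, hg, rfl⟩
    rcases hg with rfl | rfl
    · exact ⟨_, hx⟩
    · exact ⟨_, hy⟩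
  have hbij : Function.Bijective f :=
    (Nat.bijective_iff_surjective_and_card _).2 ⟨hsurj, le_antisymm
      (card_coverQuot ▸ card_grpP_le) (Nat.card_le_card_of_surjective f hsurj)⟩
  exact ⟨MulEquiv.ofBijective f hbij, hx, hy⟩

theorem card_grpP : Nat.card GrpP = 243 := by
  obtain ⟨e, -⟩ := exists_equiv
  rw [Nat.card_congr e.toEquiv, card_coverQuot]

theorem exists_coverProj : ∃ p : Cover →* GrpP, Function.Surjective p ∧
    (∀ g, p g = 1 ↔ g ∈ Subgroup.zpowers Cover.z) ∧ p Cover.x = genX ∧ p Cover.y = genY := by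
  obtain ⟨e, hx, hy⟩ := exists_equiv
  refine ⟨e.symm.toMonoidHom.comp coverMk, e.symm.surjective.comp coverMk_surjective,
    fun g => ?_, ?_, ?_⟩
  · rw [← coverMk_eq_one_iff]
    exact e.symm.map_eq_one_iff
  · exact e.symm_apply_eq.2 hx.symm
  · exact e.symm_apply_eq.2 hy.symm

/-! ### Second homology of the presented group and the action of endomorphisms. -/

/-- The lift of the first generator to the bar extension. -/
def barX : BarExt GrpP := ⟨genX, 0⟩

/-- The lift of the second generator to the bar extension. -/
def barY : BarExt GrpP := ⟨genY, 0⟩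

theorem relB_bar_base : (relB barX barY).base = 1 :=
  (map_relB BarExt.proj barX barY).trans relB_gen

theorem relC_bar_base : (relC barX barY).base = 1 :=
  (map_relC BarExt.proj barX barY).trans relC_gen

theorem barX_pow_base : (barX ^ 3).base = 1 :=
  (map_pow BarExt.proj barX 3).trans genX_pow

theorem relB_bar_pow : relB barX barY ^ 3 = 1 :=
  relB_pow_three (BarExt.mem_center barX_pow_base) (BarExt.mem_center relB_bar_base)
    (BarExt.mem_center relC_bar_base)

/-- The second relator defines a homology class. -/
theorem exists_class {G : Type} [Group G] {a b : BarExt G} (h : (relB a b).base = 1) :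
    ∃ t : H₂ G, BarExt.ofH₂ (Multiplicative.ofAdd t) = relB a b :=
  BarExt.exists_ofH₂_eq h (by rw [map_relB, relB_comm])

/-- The homology class of the second relator. -/
def relClass : H₂ GrpP := (exists_class relB_bar_base).choose

theorem ofH₂_relClass : BarExt.ofH₂ (Multiplicative.ofAdd relClass) = relB barX barY :=
  (exists_class relB_bar_base).choose_spec

theorem three_nsmul_relClass : 3 • relClass = 0 := by
  apply Multiplicative.ofAdd.injective
  apply BarExt.ofH₂_injective
  rw [ofAdd_nsmul, map_pow, ofH₂_relClass, relB_bar_pow, ofAdd_zero, map_one]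

theorem exists_zsmul_relClass (t : H₂ GrpP) : ∃ n : ℤ, t = n • relClass := by
  let Φ : FreeGroup (Fin 2) →* BarExt GrpP := FreeGroup.lift ![barX, barY]
  have hΦ0 : Φ (FreeGroup.of 0) = barX := FreeGroup.lift_apply_of
  have hΦ1 : Φ (FreeGroup.of 1) = barY := FreeGroup.lift_apply_of
  have hΦ : BarExt.proj.comp Φ = freeProj := by
    ext i
    fin_cases i
    · exact congrArg BarExt.base hΦ0
    · exact congrArg BarExt.base hΦ1
  let α : FreeGroup (Fin 2) →* Multiplicative (ℤ × ℤ) :=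
    FreeGroup.lift ![Multiplicative.ofAdd (1, 0), Multiplicative.ofAdd (0, 1)]
  have hα0 : α (FreeGroup.of 0) = Multiplicative.ofAdd (1, 0) := FreeGroup.lift_apply_of
  have hα1 : α (FreeGroup.of 1) = Multiplicative.ofAdd (0, 1) := FreeGroup.lift_apply_of
  obtain ⟨w, hw1, hw2, hw3⟩ := exists_relation_of_H₂ freeProj freeProj_surjective Φ
    (fun w => DFunLike.congr_fun hΦ w) α t
  -- Pairing with the abelianisation records exponent sums while the relators stay central.
  let Ψ := Φ.prod α
  have hc (i : Fin 3) : Ψ (relP i) ∈ Subgroup.center (BarExt GrpP × Multiplicative (ℤ × ℤ)) := by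
    rw [Subgroup.center_prod, Subgroup.mem_prod, CommGroup.center_eq_top]
    exact ⟨BarExt.mem_center ((DFunLike.congr_fun hΦ _).trans (freeProj_rel i)), trivial⟩
  obtain ⟨n, hn⟩ := exists_zpow_of_mem_normalClosure (r := 3) relP Ψ hc
    ((freeProj_eq_one_iff w).1 hw1)
  rw [Fin.prod_univ_three] at hn
  have hn1 := congrArg Prod.fst hn
  have hn2 := congrArg Prod.snd hn
  change Φ w = Φ (relP 0) ^ n 0 * Φ (relP 1) ^ n 1 * Φ (relP 2) ^ n 2 at hn1
  change α w = α (relP 0) ^ n 0 * α (relP 1) ^ n 1 * α (relP 2) ^ n 2 at hn2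
  rw [hw2, rel_zero, rel_one, rel_two, map_pow, map_relB, map_relC, relB_comm, hα0, hα1,
    relC] at hn2
  -- The exponent sums give 3n₀ - 3n₂ = 0 and -3n₂ = 0, so only the second relator survives.
  have e1 := congrArg (fun s => s.toAdd.1) hn2
  have e2 := congrArg (fun s => s.toAdd.2) hn2
  simp at e1 e2
  have hn0 : n 0 = 0 := by omega
  have hn2' : n 2 = 0 := by omega
  rw [hw3, hn0, hn2', rel_one, map_relB, hΦ0, hΦ1, ← ofH₂_relClass, zpow_zero, zpow_zero, one_mul,
    mul_one, ← map_zpow, ← ofAdd_zsmul] at hn1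
  exact ⟨n 1, Multiplicative.ofAdd.injective (BarExt.ofH₂_injective hn1)⟩

/-- Evaluation of homology classes in the covering group. -/
theorem exists_eval : ∃ Θ : BarExt GrpP →* Cover, Θ (relB barX barY) = Cover.z ∧
    ∀ a b : BarExt GrpP, (a ^ 3).base = 1 → (relB a b).base = 1 → (relC a b).base = 1 →
      Θ (relB a b) = 1 ∨ Θ (relB a b) = Cover.z := by
  obtain ⟨p, hp, hker, hx, hy⟩ := exists_coverProj
  have hc : p.ker ≤ Subgroup.center Cover := fun g hg =>
    (Subgroup.zpowers_le.2 Cover.z_mem_center) ((hker g).1 hg)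
  obtain ⟨Θ, hΘ⟩ := BarExt.exists_hom_centralExtension p hp hc
  have hmem {a : BarExt GrpP} (ha : a.base = 1) : Θ a ∈ Subgroup.zpowers Cover.z := by
    rw [← hker, hΘ, ha]
  have hdiv {g h : Cover} (hgh : p g = p h) : g * h⁻¹ ∈ Subgroup.center Cover :=
    hc (by rw [MonoidHom.mem_ker, map_mul, map_inv, hgh, mul_inv_cancel])
  refine ⟨Θ, ?_, fun a b hA hB hC => ?_⟩
  · have h := relB_mul_center (hdiv ((hΘ barX).trans hx.symm)) (hdiv ((hΘ barY).trans hy.symm))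
      Cover.x Cover.y
    rwa [inv_mul_cancel_right, inv_mul_cancel_right, Cover.relB_x_y, ← map_relB] at h
  · have hA' := hmem hA
    have hB' := hmem hB
    have hC' := hmem hC
    rw [map_pow] at hA'
    rw [map_relB] at hB' ⊢
    rw [map_relC] at hC'
    exact Cover.relB_eq_one_or hA' hB' hC'

theorem relClass_ne_zero : relClass ≠ 0 := by
  obtain ⟨Θ, h, -⟩ := exists_eval
  intro h0
  rw [← ofH₂_relClass, h0, ofAdd_zero, map_one, map_one] at h
  exact Cover.z_ne_one h.symm

/-- The image is n times the class, with n taken modulo 3. Evaluation in `Cover` turns it into zⁿ,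
which is also the second relator at a pair satisfying the relators modulo z, hence 1 or z. -/
theorem H₂map_relClass (φ : GrpP →* GrpP) :
    H₂map φ relClass = 0 ∨ H₂map φ relClass = relClass := by
  obtain ⟨Θ, hz, hΘ⟩ := exists_eval
  have hbase {a : BarExt GrpP} (ha : a.base = 1) : (BarExt.map φ a).base = 1 :=
    (congrArg φ ha).trans (map_one φ)
  have hmap : relB (BarExt.map φ barX) (BarExt.map φ barY) =
      BarExt.ofH₂ (Multiplicative.ofAdd (H₂map φ relClass)) := by
    rw [← BarExt.map_ofH₂, ofH₂_relClass, map_relB]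
  have h := hΘ (BarExt.map φ barX) (BarExt.map φ barY)
    (by rw [← map_pow]; exact hbase barX_pow_base) (by rw [← map_relB]; exact hbase relB_bar_base)
    (by rw [← map_relC]; exact hbase relC_bar_base)
  obtain ⟨n, hn⟩ := exists_zsmul_relClass (H₂map φ relClass)
  have hn3 : H₂map φ relClass = (n % 3) • relClass := by
    rw [hn, Int.emod_def, sub_zsmul, mul_comm, mul_zsmul]
    have : (3 : ℤ) • relClass = 0 := by exact_mod_cast three_nsmul_relClass
    rw [this, zsmul_zero, neg_zero, add_zero]
  rw [hmap, hn3, ofAdd_zsmul, map_zpow, map_zpow, ofH₂_relClass, hz] at h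
  have h0 := Int.emod_nonneg n (by norm_num : (3 : ℤ) ≠ 0)
  have h1 := Int.emod_lt_of_pos n (by norm_num : (0 : ℤ) < 3)
  rw [hn3]
  clear hn3 hn
  generalize n % 3 = k at *
  interval_cases k
  · exact Or.inl (zero_zsmul _)
  · exact Or.inr (one_zsmul _)
  · have : ¬(Cover.z ^ 2 = 1 ∨ Cover.z ^ 2 = Cover.z) := by decide
    exact absurd h this

theorem H₂map_eq (φ : GrpP →* GrpP) : H₂map φ = 0 ∨ H₂map φ = LinearMap.id := by
  refine (H₂map_relClass φ).imp (fun h => ?_) fun h => ?_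
  all_goals
    ext t
    obtain ⟨n, rfl⟩ := exists_zsmul_relClass t
    rw [map_zsmul, h]
    first | exact zsmul_zero n | rfl

theorem nonempty_H₂_equiv : Nonempty (H₂ GrpP ≃+ ZMod 3) := by
  have hcyc : IsAddCyclic (H₂ GrpP) :=
    ⟨relClass, fun t => by obtain ⟨n, rfl⟩ := exists_zsmul_relClass t; exact ⟨n, rfl⟩⟩
  have hord : addOrderOf relClass = 3 :=
    addOrderOf_eq_prime three_nsmul_relClass relClass_ne_zero
  have hcard : Nat.card (H₂ GrpP) = 3 := by
    rw [← hord]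
    exact (addOrderOf_eq_card_of_forall_mem_zmultiples fun t => by
      obtain ⟨n, rfl⟩ := exists_zsmul_relClass t; exact ⟨n, rfl⟩).symm
  exact ⟨(hcard ▸ zmodAddCyclicAddEquiv hcyc).symm⟩

theorem isInvariantFactors_H₂ : IsInvariantFactors (H₂ GrpP) [3] where
  one_lt := by simp
  dvd := by simp
  equiv := nonempty_H₂_equiv.map fun e =>
    e.trans
    (AddEquiv.piUnique (ι := Fin 1) fun i : Fin [3].length => ZMod ([3].get i)).symm

theorem trace_ne (φ : GrpP →* GrpP) :
    LinearMap.trace (ZMod 3) (ZMod 3 ⊗[ℤ] H₂ GrpP) ((H₂map φ).baseChange (ZMod 3)) ≠ -1 := by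
  rcases H₂map_eq φ with h | h
  · rw [h, LinearMap.baseChange_zero, map_zero]
    decide
  · have hspan (v : ZMod 3 ⊗[ℤ] H₂ GrpP) : ∃ a : ZMod 3, a • ((1 : ZMod 3) ⊗ₜ[ℤ] relClass) = v := by
      induction v using TensorProduct.induction_on with
      | zero => exact ⟨0, zero_smul _ _⟩
      | tmul s t =>
        obtain ⟨n, rfl⟩ := exists_zsmul_relClass t
        refine ⟨s * n, ?_⟩
        rw [TensorProduct.smul_tmul', smul_eq_mul, mul_one, mul_comm, ← zsmul_eq_mul]
        exact (map_zsmul ((TensorProduct.mk ℤ (ZMod 3) (H₂ GrpP)).flip relClass) n s).trans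
          (map_zsmul (TensorProduct.mk ℤ (ZMod 3) (H₂ GrpP) s) n relClass).symm
      | add v w hv hw =>
        obtain ⟨a, rfl⟩ := hv
        obtain ⟨b, rfl⟩ := hw
        exact ⟨a + b, add_smul _ _ _⟩
    have hfin : Module.Finite (ZMod 3) (ZMod 3 ⊗[ℤ] H₂ GrpP) :=
      Module.Finite.of_surjective (LinearMap.toSpanSingleton (ZMod 3) _ (1 ⊗ₜ relClass)) hspan
    have hfree : Module.Free (ZMod 3) (ZMod 3 ⊗[ℤ] H₂ GrpP) := Module.Free.of_divisionRing _ _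
    have hle : Module.finrank (ZMod 3) (ZMod 3 ⊗[ℤ] H₂ GrpP) ≤ 1 := finrank_le_one _ hspan
    rw [h, LinearMap.baseChange_id, LinearMap.trace_id]
    -- The trace of the identity is the rank, 0 or 1, and neither is -1 modulo 3.
    interval_cases Module.finrank (ZMod 3) (ZMod 3 ⊗[ℤ] H₂ GrpP) <;> decide

end Presented

end BingGroups

end

theorem proposition2p2 :
    Nat.card BingGroups.presP.PresGroup = 243 ∧
    Nonempty (BingGroups.H₂ BingGroups.presP.PresGroup ≃+ ZMod 3) ∧
    BingGroups.presP.IsEfficient ∧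
    (∀ φ : BingGroups.presP.PresGroup →* BingGroups.presP.PresGroup,
      BingGroups.H₂map φ = 0 ∨ BingGroups.H₂map φ = LinearMap.id) ∧
    BingGroups.IsBingGroup BingGroups.presP.PresGroup := by
  refine ⟨BingGroups.card_grpP, BingGroups.nonempty_H₂_equiv,
    ⟨BingGroups.finite_grpP, [3], BingGroups.isInvariantFactors_H₂, rfl⟩, BingGroups.H₂map_eq,
    BingGroups.finite_grpP, [3], BingGroups.isInvariantFactors_H₂, fun d hd φ => ?_⟩
  obtain rfl : 3 = d := by simpa using hd
  exact BingGroups.trace_ne φ
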